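/- Let $\mathcal T\subseteq[0,\infty)$ be a convex set with non-empty interior and let $\pi$ be a $\sigma$-finite real (signed) measure on $\mathbb R\times[0,\infty)$, that is $\pi=\pi^+-\pi^-$ with $\pi^\pm$ mutually singular $\sigma$-finite measures, and $|\pi|=\pi^++\pi^-$. Assume $|\pi|(\{\beta=0\})=0$. Write $L_1(\pi)=L_1(|\pi|)$; "$\pi$-a.s." means $|\pi|$-almost everywhere. For $b\in L_1(\pi)$ put $$Lb(t_1,t_2)=\int \frac{\beta^2}{t_1^{3/2}t_2^{3/2}}\,e^{-\frac{(\alpha t_1-\beta)^2}{2t_1}-\frac{(\alpha t_2-\beta)^2}{2t_2}}\,b(\alpha,\beta)\,d\pi(\alpha,\beta),\qquad (t_1,t_2)\in\mathcal T^2 .$$ Let $\lambda_0\in L_1(\pi)$ be such that $L\lambda_0\ge 0$ Lebesgue-a.e. on $\mathcal T^2$ and $C=\int_{\mathcal T^2}L\lambda_0\,dt_1dt_2>0$ (as is the case when $\lambda_0$ is the density with respect to $\pi$ of a probability measure). Put $f_\lambda=C^{-1}L\lambda$ for $\lambda \in L_1(\pi)$, let $\mathbb P$ be the distribution of the two unemployment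 spells, with density $f_{\lambda_0}$ on $\mathcal T^2$, let $Sb=f_b/f_{\lambda_0}$ be the score operator on $L_1(\pi)$, and let $\mathcal N(S)=\{b\in L_1(\pi):Sb=0\ \mathbb P\text{-a.s.}\}$. Then: 1. For each $b\in L_1(\pi)$ the integral defining $Lb$ converges absolutely for Lebesgue-a.e. $(t_1,t_2)\in\mathcal T^2$, so that $S$ is well defined. 2. If $d\pi(-\alpha,\beta)=-d\pi(\alpha,\beta)$ (the reflection $(\alpha,\beta)\mapsto(-\alpha,\beta)$ exchanges $\pi^+$ and $\pi^-$), then $$\mathcal N(S)=\{b\in L_1(\pi): b(\alpha,\beta)=e^{-4\alpha\beta}\,b(-\alpha,\beta)\ \ \pi\text{-a.s.}\}.$$ If instead $\pi$ is symmetric, $d\pi(-\alpha,\beta)=d\pi(\alpha,\beta)$ (for example a symmetric positive measure), then $$\mathcal N(S)=\{b\in L_1(\pi): b(\alpha,\beta)=-e^{-4\alpha\beta}\,b(-\alpha,\beta)\ \ \pi\text{-a.s.}\}.$$ 3. For every $\Lambda\subseteq L_1(\pi)$ with $\lambda_0\in\Lambda$, the identified set $\{\lambda\in\Lambda: f_\lambda=f_{\lambda_0}\text{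 Lebesgue-a.e. on }\mathcal T^2\}$ equals $\{\lambda\in\Lambda:\lambda=\lambda_0+b\text{ for some } b\in\mathcal N(S)\}$. 4. If $d\pi(-\alpha,\beta)=\mp d\pi(\alpha,\beta)$ and $\Lambda\ni\lambda_0$ consists of functions symmetric in $\alpha$, i.e. $\lambda(\alpha,\beta)=\lambda(-\alpha,\beta)$ $\pi$-a.s. for all $\lambda\in\Lambda$, then $\lambda_0$ is nonparametrically identified: the identified set is $\{\lambda_0\}$. -/

import Mathlib

open MeasureTheory Set
open scoped NNReal ENNReal

noncomputable section

namespace TwoSpell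

/-- The space `ℝ × [0, ∞)` of the reduced-form parameters `(α, β)`. -/
abbrev Het : Type := ℝ × ℝ≥0

/-- The reflection `(α, β) ↦ (-α, β)`. -/
def reflect (p : Het) : Het := (-p.1, p.2)

/-- A `σ`-finite real (signed) measure on `ℝ × [0, ∞)`, given by its Jordan decomposition
`π = pos - neg` into mutually singular `σ`-finite positive measures.  The choice `neg = 0`
gives the positive `σ`-finite measures. -/
structure RealMeasure where
  /-- the positive part -/
  pos : Measure Het
  /-- the negative part -/
  neg : Measure Het
  sigmaFinite_pos : SigmaFinite pos
  sigmaFinite_neg : SigmaFinite neg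
  mutuallySingular : pos ⟂ₘ neg

attribute [instance] RealMeasure.sigmaFinite_pos RealMeasure.sigmaFinite_neg

/-- The total variation `|π|`.  "`π`-almost surely" means `|π|`-almost everywhere. -/
def RealMeasure.tv (π : RealMeasure) : Measure Het := π.pos + π.neg

/-- The integral `∫ g dπ`. -/
def RealMeasure.integral (π : RealMeasure) (g : Het → ℝ) : ℝ :=
  ∫ p, g p ∂π.pos - ∫ p, g p ∂π.neg

/-- `dπ(-α, β) = -dπ(α, β)`: the reflection turns `π = pos - neg` into `-π = neg - pos`. -/
def RealMeasure.IsOdd (π : RealMeasure) : Prop :=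
  π.pos.map reflect = π.neg ∧ π.neg.map reflect = π.pos

/-- `dπ(-α, β) = dπ(α, β)`: the reflection leaves `π` unchanged. -/
def RealMeasure.IsEven (π : RealMeasure) : Prop :=
  π.pos.map reflect = π.pos ∧ π.neg.map reflect = π.neg

/-- The Banach space `L₁(π)`. -/
abbrev RealMeasure.L1 (π : RealMeasure) : Type := Lp ℝ 1 π.tv

/-- The product of two inverse Gaussian densities, at `t = (t₁, t₂)`, with parameters
`p = (α, β)`, up to a constant factor. -/
def kernel (t : ℝ × ℝ) (p : Het) : ℝ :=
  (p.2 : ℝ) ^ 2 / (t.1 ^ (3 / 2 : ℝ) * t.2 ^ (3 / 2 : ℝ)) *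
    Real.exp (-((p.1 * t.1 - p.2) ^ 2 / (2 * t.1)) - (p.1 * t.2 - p.2) ^ 2 / (2 * t.2))

/-- The mixture `∫ kernel (t₁, t₂) (α, β) h(α, β) dπ(α, β)`. -/
def mixture (π : RealMeasure) (h : π.L1) (t : ℝ × ℝ) : ℝ :=
  π.integral fun p => kernel t p * h p

/-- Lebesgue measure on `𝒯 × 𝒯`, where the two spells are observed. -/
def spellMeasure (T : Set ℝ) : Measure (ℝ × ℝ) := volume.restrict (T ×ˢ T)

/-- The normalizing constant of the true distribution of the two spells. -/
def normConst (π : RealMeasure) (T : Set ℝ) (l₀ : π.L1) : ℝ :=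
  ∫ t, mixture π l₀ t ∂spellMeasure T

/-- `l₀` generates a distribution of the two spells: its mixture is, up to a positive
normalizing constant, a probability density on `𝒯 × 𝒯`. -/
def IsTruth (π : RealMeasure) (T : Set ℝ) (l₀ : π.L1) : Prop :=
  (∀ᵐ t ∂spellMeasure T, 0 ≤ mixture π l₀ t) ∧ 0 < normConst π T l₀

/-- The density `f_l` of the (linear) model whose true parameter is `l₀`. -/
def density (π : RealMeasure) (T : Set ℝ) (l₀ l : π.L1) (t : ℝ × ℝ) : ℝ :=
  (normConst π T l₀)⁻¹ * mixture π l t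

/-- The true distribution `ℙ` of the two spells. -/
def law (π : RealMeasure) (T : Set ℝ) (l₀ : π.L1) : Measure (ℝ × ℝ) :=
  (spellMeasure T).withDensity fun t => ENNReal.ofReal (density π T l₀ l₀ t)

/-- The score operator `b ↦ (f_{l₀ + b} - f_{l₀}) / f_{l₀} = f_b / f_{l₀}`. -/
def score (π : RealMeasure) (T : Set ℝ) (l₀ b : π.L1) (t : ℝ × ℝ) : ℝ :=
  density π T l₀ b t / density π T l₀ l₀ t

/-- The kernel `𝒩(S) = {b ∈ L₁(π) : S b = 0}` of the score operator, with functions of the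
observables identified when they agree `ℙ`-almost surely. -/
def scoreKernel (π : RealMeasure) (T : Set ℝ) (l₀ : π.L1) : Set π.L1 :=
  {b | ∀ᵐ t ∂law π T l₀, score π T l₀ b t = 0}

/-- The identified set of `l₀` in the parameter space `Λ`: all `l ∈ Λ` with `f_l = f_{l₀}`
Lebesgue-almost everywhere on `𝒯 × 𝒯`. -/
def identifiedSet (π : RealMeasure) (T : Set ℝ) (l₀ : π.L1) (Λ : Set π.L1) : Set π.L1 :=
  {l | l ∈ Λ ∧ ∀ᵐ t ∂spellMeasure T, density π T l₀ l t = density π T l₀ l₀ t}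

end TwoSpell

end

/-!
For `t₁, t₂ > 0` put `s = t₁ + t₂` and `v = 1 / t₁ + 1 / t₂`.  Expanding the squares, the kernel is a
positive factor that depends only on `t` times
`weight s v (α, β) = β² exp (2αβ - (s α² + v β²) / 2)`,
and `4 < s v` holds exactly off the diagonal `t₁ = t₂`, where this function of `(α, β)` is bounded.
Hence the mixture of `b ∈ L₁(π)` exists off the diagonal, and it vanishes at `t` if and only if
`F(s, v) = ∫ weight s v · b dπ` does.

`F` is a Laplace transform in `(α², β²)`, so it is analytic in each of `s` and `v`.  The score of `b`
vanishes `ℙ`-almost surely only if `F` vanishes on a set of positive measure, namely where the true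
density is positive.  One-variable identity theorems, along the lines `t₁ + t₂ = s` and then in `s`
and in `v`, propagate the zero to all `s, v > 0` with `4 < s v` (`integral_weight_eq_zero`).  So the
score kernel consists of the `b` whose mixture is zero, which gives the identified set by linearity.

By Stone-Weierstrass (`ext_of_forall_integral_exp_neg_sq`), `F = 0` says that the image of
`weight s v · b · π` under `(α, β) ↦ (|α|, β)` is zero, i.e. that its sum with its reflection is
zero (`ae_add_reflect_eq_zero`).  Since the reflection multiplies `weight s v` by `exp (-4αβ)` and `π`
by a sign, this is the stated equation for `b`.  If moreover `b` is even, it reads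
`(1 ∓ exp (-4αβ)) b = 0`, which forces `b = 0` because `β ≠ 0` almost everywhere, and `α ≠ 0` almost
everywhere when `π` is odd.
-/

namespace TwoSpell

/-! ### Exponential integrals -/

theorem integrable_withDensity_ofReal {Ω : Type*} [MeasurableSpace Ω] {μ : Measure Ω}
    {c g : Ω → ℝ} (hc : Measurable c) (hg : Integrable (fun ω => g ω * c ω) μ)
    (hgm : AEStronglyMeasurable g μ) :
    Integrable g (μ.withDensity fun ω => ENNReal.ofReal (c ω)) := by
  rw [integrable_withDensity_iff_integrable_smul' (by fun_prop) (by simp)]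
  refine hg.mono
    (hc.ennreal_ofReal.ennreal_toReal.aestronglyMeasurable.smul hgm) (ae_of_all _ fun ω => ?_)
  rw [ENNReal.toReal_ofReal', smul_eq_mul, norm_mul, norm_mul, mul_comm]
  gcongr
  rw [Real.norm_eq_abs, Real.norm_eq_abs, abs_of_nonneg (le_max_right _ _)]
  exact max_le (le_abs_self _) (abs_nonneg _)

/-- The signed measure `c · μ` as the difference of the positive measures `c⁺ · μ` and `c⁻ · μ`. -/
theorem integral_mul_eq_withDensity_sub {Ω : Type*} [MeasurableSpace Ω] {μ : Measure Ω}
    {c g : Ω → ℝ} (hc : Measurable c) (hg : Integrable (fun ω => g ω * c ω) μ)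
    (hgm : AEStronglyMeasurable g μ) :
    ∫ ω, g ω * c ω ∂μ = ∫ ω, g ω ∂(μ.withDensity fun ω => ENNReal.ofReal (c ω))
      - ∫ ω, g ω ∂(μ.withDensity fun ω => ENNReal.ofReal (-c ω)) := by
  have h1 := integrable_withDensity_ofReal hc hg hgm
  have h2 := integrable_withDensity_ofReal hc.neg
    (by simpa only [Pi.neg_apply, mul_neg] using! hg.neg) hgm
  rw [integrable_withDensity_iff_integrable_smul' (by fun_prop) (by simp)] at h1
  rw [integrable_withDensity_iff_integrable_smul' (by measurability) (by simp)] at h2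
  rw [integral_withDensity_eq_integral_toReal_smul (by fun_prop) (by simp),
    integral_withDensity_eq_integral_toReal_smul (by fun_prop) (by simp),
    ← integral_sub h1 (by simpa only [Pi.neg_apply] using h2)]
  refine integral_congr_ae (ae_of_all _ fun ω => ?_)
  simp only [ENNReal.toReal_ofReal', smul_eq_mul]
  rcases le_total 0 (c ω) with h | h
  · rw [max_eq_left h, max_eq_right (by linarith)]; ring
  · rw [max_eq_right h, max_eq_left (by linarith)]; ring

/-- The integral is the difference of the moment generating functions of `X` under `c⁺ · μ` and
`c⁻ · μ`, which are analytic where they are finite. -/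
theorem analyticOnNhd_integral_exp_mul {Ω : Type*} [MeasurableSpace Ω] {μ : Measure Ω}
    {X c : Ω → ℝ} (hX : Measurable X) (hc : Measurable c) {I : Set ℝ} (hI : IsOpen I)
    (h : ∀ x ∈ I, Integrable (fun ω => Real.exp (x * X ω) * c ω) μ) :
    AnalyticOnNhd ℝ (fun x => ∫ ω, Real.exp (x * X ω) * c ω ∂μ) I := by
  have key : ∀ d : Ω → ℝ, Measurable d →
      (∀ x ∈ I, Integrable (fun ω => Real.exp (x * X ω) * d ω) μ) →
      AnalyticOnNhd ℝ (ProbabilityTheory.mgf X (μ.withDensity fun ω => ENNReal.ofReal (d ω))) I := by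
    intro d hd hint
    refine ProbabilityTheory.analyticOnNhd_mgf.mono (interior_maximal (fun x hx => ?_) hI)
    exact integrable_withDensity_ofReal hd (hint x hx) (by fun_prop)
  refine ((key c hc h).sub (key (fun ω => -c ω) hc.neg fun x hx => ?_)).congr hI fun x hx => ?_
  · simpa only [mul_neg] using! (h x hx).neg
  · exact (integral_mul_eq_withDensity_sub hc (h x hx) (by fun_prop)).symm

/-- The zeros of a nonzero analytic function are isolated, so they form a null set. -/
theorem eqOn_zero_of_volume_ne_zero {f : ℝ → ℝ} {I : Set ℝ} (hf : AnalyticOnNhd ℝ f I)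
    (hI : IsPreconnected I) (hIm : MeasurableSet I) (h : volume (I ∩ {x | f x = 0}) ≠ 0) :
    ∀ x ∈ I, f x = 0 := by
  intro x hx
  by_contra hne
  have h1 := hf.preimage_zero_mem_codiscreteWithin hne hx ⟨⟨x, hx⟩, hI⟩
  have h2 : ∀ᵐ y ∂volume.restrict I, f y ≠ 0 := ae_restrict_le_codiscreteWithin hIm h1
  rw [ae_restrict_iff' hIm] at h2
  refine h (measure_mono_null (fun y hy => ?_) (ae_iff.1 h2))
  simpa using ⟨hy.1, hy.2⟩

open BoundedContinuousFunction in
/-- The functions `exp (-(m x² + n y²))` are closed under multiplication and separate the points of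
the quadrant, so by Stone-Weierstrass they determine finite measures on it. -/
theorem ext_of_forall_integral_exp_neg_sq {P Q : Measure (ℝ≥0 × ℝ≥0)} [IsFiniteMeasure P]
    [IsFiniteMeasure Q]
    (h : ∀ m n : ℕ, ∫ x, Real.exp (-(m * (x.1 : ℝ) ^ 2 + n * (x.2 : ℝ) ^ 2)) ∂P
      = ∫ x, Real.exp (-(m * (x.1 : ℝ) ^ 2 + n * (x.2 : ℝ) ^ 2)) ∂Q) : P = Q := by
  let e : ℕ → ℕ → (ℝ≥0 × ℝ≥0 →ᵇ ℝ) := fun m n => ofNormedAddCommGroup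
    (fun x => Real.exp (-(m * (x.1 : ℝ) ^ 2 + n * (x.2 : ℝ) ^ 2))) (by fun_prop) 1 (fun x => by
      rw [Real.norm_eq_abs, Real.abs_exp, Real.exp_le_one_iff]
      have : (0 : ℝ) ≤ m * (x.1 : ℝ) ^ 2 + n * (x.2 : ℝ) ^ 2 := by positivity
      linarith)
  -- closed under multiplication, so the algebra that it generates is its linear span
  let M : Submonoid (ℝ≥0 × ℝ≥0 →ᵇ ℝ) :=
    { carrier := {g | ∃ m n, g = e m n}
      one_mem' := ⟨0, 0, by ext x; simp [e]⟩
      mul_mem' := by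
        rintro _ _ ⟨m, n, rfl⟩ ⟨m', n', rfl⟩
        refine ⟨m + m', n + n', ?_⟩
        ext x
        simp only [e, coe_mul, Pi.mul_apply, coe_ofNormedAddCommGroup, ← Real.exp_add]
        push_cast
        ring_nf }
  let A : StarSubalgebra ℝ (ℝ≥0 × ℝ≥0 →ᵇ ℝ) :=
    { Algebra.adjoin ℝ (M : Set (ℝ≥0 × ℝ≥0 →ᵇ ℝ)) with
      star_mem' := fun {g} hg => by
        have : star g = g := by ext x; simp
        rw [this]; exact hg }
  have hA : ∀ g, g ∈ A ↔ g ∈ Algebra.adjoin ℝ (M : Set (ℝ≥0 × ℝ≥0 →ᵇ ℝ)) := fun g => Iff.rfl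
  refine ext_of_forall_mem_subalgebra_integral_eq_of_polish (𝕜 := ℝ) (A := A) ?_ ?_
  · intro x y hxy
    have hmem : ∀ m n, (e m n : ℝ≥0 × ℝ≥0 → ℝ) ∈
        ((fun f : C(ℝ≥0 × ℝ≥0, ℝ) => (f : ℝ≥0 × ℝ≥0 → ℝ)) ''
          ((A.map (toContinuousMapStarₐ ℝ) : StarSubalgebra ℝ C(ℝ≥0 × ℝ≥0, ℝ)) :
            Set C(ℝ≥0 × ℝ≥0, ℝ))) := fun m n =>
      ⟨toContinuousMapStarₐ ℝ (e m n), ⟨e m n, Algebra.subset_adjoin ⟨m, n, rfl⟩, rfl⟩, rfl⟩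
    by_cases h1 : x.1 = y.1
    · have h2 : x.2 ≠ y.2 := fun h2 => hxy (Prod.ext h1 h2)
      refine ⟨_, hmem 0 1, fun heq => h2 ?_⟩
      simpa [e] using heq
    · refine ⟨_, hmem 1 0, fun heq => h1 ?_⟩
      simpa [e] using heq
  · intro g hg
    rw [hA, ← Subalgebra.mem_toSubmodule, Algebra.adjoin_eq_span, Submonoid.closure_eq] at hg
    induction hg using Submodule.span_induction with
    | mem g hg =>
      obtain ⟨m, n, rfl⟩ := hg
      exact h m n
    | zero => simp
    | add f g _ _ hf hg =>
      simp only [coe_add, Pi.add_apply]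
      rw [integral_add (f.integrable _) (g.integrable _),
        integral_add (f.integrable _) (g.integrable _), hf, hg]
    | smul a f _ hf =>
      simp only [coe_smul]
      rw [integral_smul, integral_smul, hf]

/-! ### The weight -/

/-- The part of the kernel that depends on the parameters, in the coordinates `s = t₁ + t₂` and
`v = 1 / t₁ + 1 / t₂` (see `kernel_eq`).  In each of them separately it is an exponential. -/
noncomputable def weight (s v : ℝ) (p : Het) : ℝ :=
  (p.2 : ℝ) ^ 2 * Real.exp (2 * p.1 * p.2 - (s * p.1 ^ 2 + v * (p.2 : ℝ) ^ 2) / 2)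

theorem measurable_weight (s v : ℝ) : Measurable (weight s v) := by
  unfold weight; fun_prop

theorem measurable_reflect : Measurable reflect := by
  unfold reflect; fun_prop

theorem reflect_reflect (p : Het) : reflect (reflect p) = p := by
  simp [reflect]

/-- Completing the square in `α` leaves `exp (-d β²)` with `d = (s v - 4) / (2 s) > 0`. -/
theorem weight_le {s v : ℝ} (hs : 0 < s) (hv : 4 < s * v) (p : Het) :
    weight s v p ≤ 2 * s / (s * v - 4) := by
  obtain ⟨a, b⟩ := p
  have hd : 0 < (s * v - 4) / (2 * s) := div_pos (by linarith) (by linarith)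
  have h1 : 2 * a * b - (s * a ^ 2 + v * (b : ℝ) ^ 2) / 2
      ≤ -((s * v - 4) / (2 * s) * (b : ℝ) ^ 2) := by
    have h2 : 0 ≤ (s * a - 2 * b) ^ 2 / (2 * s) := by positivity
    have h3 : 2 * a * b - (s * a ^ 2 + v * (b : ℝ) ^ 2) / 2
      = -((s * v - 4) / (2 * s) * (b : ℝ) ^ 2) - (s * a - 2 * b) ^ 2 / (2 * s) := by
      field_simp; ring
    linarith
  have h4 := Real.add_one_le_exp ((s * v - 4) / (2 * s) * (b : ℝ) ^ 2)
  rw [show 2 * s / (s * v - 4) = ((s * v - 4) / (2 * s))⁻¹ by rw [inv_div]]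
  generalize (s * v - 4) / (2 * s) = d at *
  calc weight s v (a, b) ≤ (b : ℝ) ^ 2 * Real.exp (-(d * (b : ℝ) ^ 2)) := by
        unfold weight; gcongr
    _ = (b : ℝ) ^ 2 / Real.exp (d * (b : ℝ) ^ 2) := by rw [Real.exp_neg]; rfl
    _ ≤ d⁻¹ := by
        rw [div_le_iff₀ (Real.exp_pos _), inv_mul_eq_div, le_div_iff₀ hd]
        linarith

theorem integral_comp_reflect {μ : Measure Het} (hμ : μ.map reflect = μ) {w : Het → ℝ}
    (hw : Measurable w) : ∫ p, w (reflect p) ∂μ = ∫ p, w p ∂μ := by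
  conv_rhs => rw [← hμ]
  rw [integral_map measurable_reflect.aemeasurable hw.aestronglyMeasurable]

theorem weight_nonneg (s v : ℝ) (p : Het) : 0 ≤ weight s v p := by
  unfold weight; positivity

theorem integrable_weight_mul {μ : Measure Het} {c : Het → ℝ} (hc : Integrable c μ) {s v : ℝ}
    (hs : 0 < s) (hv : 4 < s * v) : Integrable (fun p => weight s v p * c p) μ :=
  hc.bdd_mul (c := 2 * s / (s * v - 4)) (measurable_weight s v).aestronglyMeasurable <|
    ae_of_all _ fun p => by
      rw [Real.norm_eq_abs, abs_of_nonneg (weight_nonneg s v p)]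
      exact weight_le hs hv p

theorem analyticOnNhd_integral_weight_fst {μ : Measure Het} {c : Het → ℝ} (hcm : Measurable c)
    (hc : Integrable c μ) {v : ℝ} (hv : 0 < v) :
    AnalyticOnNhd ℝ (fun s => ∫ p, weight s v p * c p ∂μ) (Ioi (4 / v)) := by
  have heq : ∀ s p, weight s v p * c p = Real.exp (s * (-p.1 ^ 2 / 2)) * (weight 0 v p * c p) := by
    intro s p
    rw [← mul_assoc]
    congr 1
    unfold weight
    rw [mul_left_comm, ← Real.exp_add]
    ring_nf
  have hint : ∀ s ∈ Ioi (4 / v), Integrable (fun p => weight s v p * c p) μ := fun s hs =>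
    integrable_weight_mul hc ((div_pos (by norm_num) hv).trans hs) ((div_lt_iff₀ hv).1 hs)
  simpa only [← heq] using analyticOnNhd_integral_exp_mul (X := fun p : Het => -p.1 ^ 2 / 2)
    (c := fun p => weight 0 v p * c p) (by fun_prop) ((measurable_weight 0 v).mul hcm) isOpen_Ioi
    fun s hs => (hint s hs).congr (ae_of_all _ (heq s))

theorem analyticOnNhd_integral_weight_snd {μ : Measure Het} {c : Het → ℝ} (hcm : Measurable c)
    (hc : Integrable c μ) {s : ℝ} (hs : 0 < s) :
    AnalyticOnNhd ℝ (fun v => ∫ p, weight s v p * c p ∂μ) (Ioi (4 / s)) := by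
  have heq : ∀ v p, weight s v p * c p =
      Real.exp (v * (-(p.2 : ℝ) ^ 2 / 2)) * (weight s 0 p * c p) := by
    intro v p
    rw [← mul_assoc]
    congr 1
    unfold weight
    rw [mul_left_comm, ← Real.exp_add]
    ring_nf
  have hint : ∀ v ∈ Ioi (4 / s), Integrable (fun p => weight s v p * c p) μ := fun v hv =>
    integrable_weight_mul hc hs ((div_lt_iff₀' hs).1 hv)
  simpa only [← heq] using analyticOnNhd_integral_exp_mul (X := fun p : Het => -(p.2 : ℝ) ^ 2 / 2)
    (c := fun p => weight s 0 p * c p) (by fun_prop) ((measurable_weight s 0).mul hcm) isOpen_Ioi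
    fun v hv => (hint v hv).congr (ae_of_all _ (heq v))

/-! ### The identity theorem for the mixture -/

/-- The points `t` off the diagonal of the quadrant have coordinates `(s, v)` with `4 < s v`. -/
theorem four_lt_sum_mul {x y : ℝ} (hx : 0 < x) (hy : 0 < y) (hxy : x ≠ y) :
    4 < (x + y) * ((x + y) / (x * y)) := by
  rw [← mul_div_assoc, lt_div_iff₀ (by positivity)]
  nlinarith [sq_pos_of_ne_zero (sub_ne_zero.2 hxy)]

/-- On the line `t₁ + t₂ = s`, parametrized by `x = t₁`, the second coordinate is
`v = s / (x (s - x))`; a function that is analytic in `v` vanishes as soon as it does so at a set of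
positive length on the line. -/
theorem eqOn_zero_of_volume_slice_ne_zero {G : ℝ → ℝ} {s : ℝ} (hs : 0 < s)
    (hG : AnalyticOnNhd ℝ G (Ioi (4 / s)))
    (h : volume {x | 0 < x ∧ 0 < s - x ∧ x ≠ s - x ∧ G (s / (x * (s - x))) = 0} ≠ 0) :
    ∀ v ∈ Ioi (4 / s), G v = 0 := by
  set Z := {x | 0 < x ∧ 0 < s - x ∧ x ≠ s - x ∧ G (s / (x * (s - x))) = 0} with hZ
  -- on either half of `(0, s)` the map `x ↦ s / (x * (s - x))` is onto `(4 / s, ∞)`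
  have key : ∀ I : Set ℝ, IsPreconnected I → MeasurableSet I →
      (∀ x ∈ I, 0 < x ∧ 0 < s - x ∧ x ≠ s - x) →
      (∀ v ∈ Ioi (4 / s), ∃ x ∈ I, s / (x * (s - x)) = v) → volume (I ∩ Z) ≠ 0 →
      ∀ v ∈ Ioi (4 / s), G v = 0 := by
    intro I hI hIm hIs hsurj hvol v hv
    obtain ⟨x, hx, rfl⟩ := hsurj v hv
    refine eqOn_zero_of_volume_ne_zero (f := fun x => G (s / (x * (s - x)))) (I := I)
      (fun y hy => ?_) hI hIm (fun h0 => hvol (measure_mono_null ?_ h0)) x hx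
    · obtain ⟨h1, h2, h3⟩ := hIs y hy
      refine AnalyticAt.fun_comp (hG _ ?_) ?_
      · rw [mem_Ioi, div_lt_iff₀' hs]
        simpa using four_lt_sum_mul h1 h2 h3
      · exact analyticAt_const.div (by fun_prop) (mul_pos h1 h2).ne'
    · exact fun y hy => ⟨hy.1, hy.2.2.2.2⟩
  have hroot : ∀ v ∈ Ioi (4 / s), 0 < √(s ^ 2 - 4 * s / v) ∧ √(s ^ 2 - 4 * s / v) < s ∧
      √(s ^ 2 - 4 * s / v) ^ 2 = s ^ 2 - 4 * s / v ∧ 0 < v := by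
    intro v hv
    have hv0 : 0 < v := (div_pos (by norm_num) hs).trans hv
    rw [mem_Ioi, div_lt_iff₀' hs] at hv
    have h1 : 0 < s ^ 2 - 4 * s / v := by
      rw [sub_pos, div_lt_iff₀ hv0]; nlinarith
    refine ⟨Real.sqrt_pos.2 h1, ?_, Real.sq_sqrt h1.le, hv0⟩
    rw [Real.sqrt_lt' hs, sub_lt_self_iff]
    positivity
  by_cases hleft : volume (Ioo 0 (s / 2) ∩ Z) = 0
  · refine key (Ioo (s / 2) s) isPreconnected_Ioo measurableSet_Ioo
      (fun x hx => ⟨by linarith [hx.1], by linarith [hx.2], by linarith [hx.1]⟩)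
      (fun v hv => ?_) (fun hright => h ?_)
    · obtain ⟨h1, h2, h3, h4⟩ := hroot v hv
      refine ⟨(s + √(s ^ 2 - 4 * s / v)) / 2, ⟨by linarith, by linarith⟩, ?_⟩
      rw [show (s + √(s ^ 2 - 4 * s / v)) / 2 * (s - (s + √(s ^ 2 - 4 * s / v)) / 2)
        = (s ^ 2 - √(s ^ 2 - 4 * s / v) ^ 2) / 4 by ring, h3]
      field_simp
      ring
    · refine measure_mono_null (fun x hx => ?_) (measure_union_null hleft hright)
      rcases lt_or_gt_of_ne hx.2.2.1 with h1 | h1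
      · exact Or.inl ⟨⟨hx.1, by linarith⟩, hx⟩
      · exact Or.inr ⟨⟨by linarith, by linarith [hx.2.1]⟩, hx⟩
  · refine key (Ioo 0 (s / 2)) isPreconnected_Ioo measurableSet_Ioo
      (fun x hx => ⟨hx.1, by linarith [hx.1, hx.2], by linarith [hx.2]⟩)
      (fun v hv => ?_) hleft
    obtain ⟨h1, h2, h3, h4⟩ := hroot v hv
    refine ⟨(s - √(s ^ 2 - 4 * s / v)) / 2, ⟨by linarith, by linarith⟩, ?_⟩
    rw [show (s - √(s ^ 2 - 4 * s / v)) / 2 * (s - (s - √(s ^ 2 - 4 * s / v)) / 2)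
      = (s ^ 2 - √(s ^ 2 - 4 * s / v) ^ 2) / 4 by ring, h3]
    field_simp
    ring

/-- The identity theorem for the mixture: zeros of positive planar measure force it to vanish
identically.  Analyticity is needed in one variable at a time only. -/
theorem integral_weight_eq_zero {μ : Measure Het} {c : Het → ℝ} (hcm : Measurable c)
    (hc : Integrable c μ) {Z : Set (ℝ × ℝ)} (hZm : MeasurableSet Z) (hZ0 : volume Z ≠ 0)
    (hZ : ∀ t ∈ Z, 0 < t.1 ∧ 0 < t.2 ∧ t.1 ≠ t.2 ∧
      ∫ p, weight (t.1 + t.2) ((t.1 + t.2) / (t.1 * t.2)) p * c p ∂μ = 0)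
    {s v : ℝ} (hs : 0 < s) (hv : 4 < s * v) : ∫ p, weight s v p * c p ∂μ = 0 := by
  set F : ℝ → ℝ → ℝ := fun s v => ∫ p, weight s v p * c p ∂μ with hF
  -- the lines `t₁ + t₂ = s` on which `F` vanishes; by Fubini there are many of them
  set A : Set ℝ := {s | 0 < s ∧ ∀ v ∈ Ioi (4 / s), F s v = 0} with hA
  have hA0 : volume A ≠ 0 := by
    intro hA0
    have hmp := measurePreserving_prod_sub_swap (volume : Measure ℝ) (volume : Measure ℝ)
    have hmp : MeasurePreserving (fun z : ℝ × ℝ => (z.2, z.1 - z.2)) volume volume := hmp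
    rw [← hmp.measure_preimage hZm.nullMeasurableSet] at hZ0
    refine hZ0 ((Measure.measure_prod_null (hmp.measurable hZm)).2 ?_)
    refine Filter.mem_of_superset (compl_mem_ae_iff.2 hA0) fun s hsA => ?_
    by_contra hne
    refine hsA ?_
    have hpos : 0 < s := by
      obtain ⟨x, hx⟩ := nonempty_of_measure_ne_zero hne
      have := hZ _ hx
      simp only at this
      linarith [this.1, this.2.1]
    refine ⟨hpos, eqOn_zero_of_volume_slice_ne_zero hpos
      (analyticOnNhd_integral_weight_snd hcm hc hpos)
      fun h0 => hne (measure_mono_null (fun x hx => ?_) h0)⟩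
    have := hZ _ hx
    simp only [add_sub_cancel] at this
    exact this
  -- for all `v ≥ n + 1`, the horizontal line at height `v` crosses the part of `A` that is kept here
  obtain ⟨n, hn⟩ : ∃ n : ℕ, volume (A ∩ Ioi (4 / (n + 1 : ℝ))) ≠ 0 := by
    by_contra! hcon
    refine hA0 (measure_mono_null (fun s hs => ?_) (measure_iUnion_null hcon))
    obtain ⟨n, hn⟩ := exists_nat_one_div_lt (show 0 < s / 4 by linarith [hs.1])
    refine mem_iUnion.2 ⟨n, hs, ?_⟩
    rw [mem_Ioi]
    have : 4 / (n + 1 : ℝ) = 4 * (1 / (n + 1)) := by ring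
    linarith
  have hlarge : ∀ v : ℝ, (n + 1 : ℝ) ≤ v → ∀ s ∈ Ioi (4 / v), F s v = 0 := by
    intro v hnv
    have hn1 : (0 : ℝ) < n + 1 := by positivity
    have hv0 : 0 < v := by linarith
    refine eqOn_zero_of_volume_ne_zero (analyticOnNhd_integral_weight_fst hcm hc hv0)
      isPreconnected_Ioi measurableSet_Ioi fun h0 => hn (measure_mono_null (fun s hs => ?_) h0)
    have h1 : 4 / v < s := (div_le_div_of_nonneg_left (by norm_num) hn1 hnv).trans_lt hs.2
    refine ⟨h1, hs.1.2 v ?_⟩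
    rw [div_lt_iff₀ hv0] at h1
    rw [mem_Ioi, div_lt_iff₀ hs.1.1]
    linarith
  refine eqOn_zero_of_volume_ne_zero (analyticOnNhd_integral_weight_snd hcm hc hs)
    isPreconnected_Ioi measurableSet_Ioi (fun h0 => ?_) v ((div_lt_iff₀' hs).2 hv)
  have h1 : volume (Ioi (max (4 / s) (n + 1))) = 0 := by
    refine measure_mono_null (fun w hw => ?_) h0
    have h2 : 4 / s < w := (le_max_left _ _).trans_lt hw
    have h3 : (n + 1 : ℝ) < w := (le_max_right _ _).trans_lt hw
    have hw0 : 0 < w := (div_pos (by norm_num) hs).trans h2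
    refine ⟨h2, hlarge w h3.le s ?_⟩
    rw [div_lt_iff₀ hs] at h2
    rw [mem_Ioi, div_lt_iff₀ hw0]
    linarith
  simp at h1

/-! ### Uniqueness of the even part -/

theorem measurable_exp_neg_sq (m n : ℕ) :
    Measurable fun p : Het => Real.exp (-(m * p.1 ^ 2 + n * (p.2 : ℝ) ^ 2)) := by
  fun_prop

theorem integrable_exp_neg_sq_mul {μ : Measure Het} {g : Het → ℝ} (hg : Integrable g μ)
    (m n : ℕ) :
    Integrable (fun p => Real.exp (-(m * p.1 ^ 2 + n * (p.2 : ℝ) ^ 2)) * g p) μ := by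
  refine hg.bdd_mul (c := 1) (measurable_exp_neg_sq m n).aestronglyMeasurable
    (ae_of_all _ fun p => ?_)
  rw [Real.norm_eq_abs, Real.abs_exp, Real.exp_le_one_iff, neg_nonpos]
  positivity

/-- An even function is a function of `(|α|, β)`, so the set where it is positive is the preimage of
a set in the quadrant, where the measures `w⁺ · μ` and `w⁻ · μ` have the same image. -/
theorem ae_nonpos_of_forall_integral_eq_zero {μ : Measure Het} {w : Het → ℝ} (hwm : Measurable w)
    (hw : Integrable w μ) (heven : ∀ p, w (reflect p) = w p)
    (h : ∀ m n : ℕ, ∫ p, Real.exp (-(m * p.1 ^ 2 + n * (p.2 : ℝ) ^ 2)) * w p ∂μ = 0) :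
    ∀ᵐ p ∂μ, w p ≤ 0 := by
  set φ : Het → ℝ≥0 × ℝ≥0 := fun p => (‖p.1‖₊, p.2) with hφ
  have hφm : Measurable φ := by fun_prop
  set P := μ.withDensity fun p => ENNReal.ofReal (w p) with hP
  set Q := μ.withDensity fun p => ENNReal.ofReal (-w p) with hQ
  have : IsFiniteMeasure P := isFiniteMeasure_withDensity_ofReal hw.2
  have : IsFiniteMeasure Q := isFiniteMeasure_withDensity_ofReal hw.neg.2
  have hPQ : P.map φ = Q.map φ := by
    refine ext_of_forall_integral_exp_neg_sq fun m n => ?_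
    rw [integral_map hφm.aemeasurable (by fun_prop), integral_map hφm.aemeasurable (by fun_prop),
      ← sub_eq_zero]
    simp only [hφ, coe_nnnorm, Real.norm_eq_abs, sq_abs]
    rw [← integral_mul_eq_withDensity_sub hwm (integrable_exp_neg_sq_mul hw m n)
      (measurable_exp_neg_sq m n).aestronglyMeasurable, h]
  set B : Set (ℝ≥0 × ℝ≥0) := {x | 0 < w ((x.1 : ℝ), x.2)} with hB
  have hBm : MeasurableSet B := measurableSet_lt measurable_const (by fun_prop)
  have hpre : φ ⁻¹' B = {p | 0 < w p} := by
    ext ⟨a, b⟩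
    simp only [hφ, hB, mem_preimage, mem_ofPred_eq, coe_nnnorm, Real.norm_eq_abs]
    rcases abs_choice a with h | h <;> rw [h]
    rw [show ((-a, b) : Het) = reflect (a, b) from rfl, heven]
  have hQB : Q (φ ⁻¹' B) = 0 := by
    rw [hpre, hQ, withDensity_apply_eq_zero (by fun_prop)]
    convert measure_empty (μ := μ) using 2
    ext p
    simpa using fun h1 : w p < 0 => h1.le
  have hPB : P (φ ⁻¹' B) = 0 := by
    rw [← Measure.map_apply hφm hBm, hPQ, Measure.map_apply hφm hBm, hQB]
  rw [hpre, hP, withDensity_apply_eq_zero (by fun_prop)] at hPB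
  rw [ae_iff]
  refine measure_mono_null (fun p hp => ?_) hPB
  simpa using hp

/-- The transform in `(α², β²)` of a function determines its even part. -/
theorem ae_add_reflect_eq_zero {μ : Measure Het} (hμ : μ.map reflect = μ) {w : Het → ℝ}
    (hwm : Measurable w) (hw : Integrable w μ)
    (h : ∀ m n : ℕ, ∫ p, Real.exp (-(m * p.1 ^ 2 + n * (p.2 : ℝ) ^ 2)) * w p ∂μ = 0) :
    ∀ᵐ p ∂μ, w p + w (reflect p) = 0 := by
  have hmp : MeasurePreserving reflect μ μ := ⟨measurable_reflect, hμ⟩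
  have hwr : Integrable (fun p => w (reflect p)) μ := hmp.integrable_comp_of_integrable hw
  have h' : ∀ m n : ℕ,
      ∫ p, Real.exp (-(m * p.1 ^ 2 + n * (p.2 : ℝ) ^ 2)) * w (reflect p) ∂μ = 0 := fun m n => by
    refine Eq.trans ?_
      ((integral_comp_reflect hμ ((measurable_exp_neg_sq m n).mul hwm)).trans (h m n))
    simp [reflect]
  have hsum : ∀ m n : ℕ, ∫ p, Real.exp (-(m * p.1 ^ 2 + n * (p.2 : ℝ) ^ 2)) *
      (w p + w (reflect p)) ∂μ = 0 := by
    intro m n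
    simp_rw [mul_add]
    rw [integral_add (integrable_exp_neg_sq_mul hw m n) (integrable_exp_neg_sq_mul hwr m n), h, h', add_zero]
  have hme : Measurable fun p => w p + w (reflect p) := hwm.add (hwm.comp measurable_reflect)
  have h1 := ae_nonpos_of_forall_integral_eq_zero hme (hw.add hwr)
    (fun p => by rw [reflect_reflect, add_comm]) hsum
  have h2 := ae_nonpos_of_forall_integral_eq_zero hme.neg (hw.add hwr).neg
    (fun p => by simp only [Pi.neg_apply, reflect_reflect, add_comm])
    (fun m n => by simp only [Pi.neg_apply, mul_neg, integral_neg, hsum, neg_zero])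
  filter_upwards [h1, h2] with p hp1 hp2
  simp only [Pi.neg_apply] at hp2
  linarith

/-! ### Reflection and sign -/

theorem weight_reflect (s v : ℝ) (p : Het) :
    weight s v (reflect p) = Real.exp (-4 * p.1 * p.2) * weight s v p := by
  unfold weight reflect
  rw [mul_left_comm, ← Real.exp_add]
  ring_nf

theorem weight_pos (s v : ℝ) {p : Het} (hp : p.2 ≠ 0) : 0 < weight s v p := by
  have : (p.2 : ℝ) ≠ 0 := by exact_mod_cast hp
  unfold weight; positivity

theorem kernel_eq {t : ℝ × ℝ} (h1 : 0 < t.1) (h2 : 0 < t.2) (p : Het) :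
    kernel t p = (t.1 ^ (3 / 2 : ℝ) * t.2 ^ (3 / 2 : ℝ))⁻¹ *
      weight (t.1 + t.2) ((t.1 + t.2) / (t.1 * t.2)) p := by
  unfold kernel weight
  rw [div_eq_inv_mul, mul_assoc]
  congr 3
  field_simp
  ring

theorem isSFinite_tv (π : RealMeasure) : SFinite π.tv := by
  unfold RealMeasure.tv; infer_instance

/-- The density `σ = dπ / d|π|` of `π` with respect to its total variation, with values `±1`
everywhere. -/
structure IsSign (π : RealMeasure) (σ : Het → ℝ) : Prop where
  measurable : Measurable σ
  eq_or_eq : ∀ p, σ p = 1 ∨ σ p = -1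
  ae_pos : ∀ᵐ p ∂π.pos, σ p = 1
  ae_neg : ∀ᵐ p ∂π.neg, σ p = -1

/-- The sign changes across a Hahn decomposition. -/
theorem exists_isSign (π : RealMeasure) : ∃ σ : Het → ℝ, IsSign π σ := by
  classical
  obtain ⟨A, hA, hpos, hneg⟩ := π.mutuallySingular
  refine ⟨A.piecewise (fun _ => -1) fun _ => 1,
    measurable_const.piecewise hA measurable_const, fun p => ?_, ?_, ?_⟩
  · by_cases hp : p ∈ A <;> simp [hp]
  · filter_upwards [compl_mem_ae_iff.2 hpos] with p hp
    exact piecewise_eq_of_notMem _ _ _ hp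
  · filter_upwards [mem_ae_iff.2 hneg] with p hp
    exact piecewise_eq_of_mem _ _ _ hp

variable {π : RealMeasure} {σ : Het → ℝ}

theorem IsSign.integral_eq (hσ : IsSign π σ) {g : Het → ℝ} (hg : Integrable g π.tv) :
    π.integral g = ∫ p, σ p * g p ∂π.tv := by
  have hg' : Integrable (fun p => σ p * g p) π.tv :=
    hg.bdd_mul (c := 1) hσ.measurable.aestronglyMeasurable <| ae_of_all _ fun p => by
      rcases hσ.eq_or_eq p with h | h <;> simp [h]
  rw [RealMeasure.tv, integrable_add_measure] at hg'
  rw [RealMeasure.tv, integral_add_measure hg'.1 hg'.2, RealMeasure.integral, sub_eq_add_neg,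
    ← integral_neg]
  congr 1
  · exact integral_congr_ae (hσ.ae_pos.mono fun p hp => by simp [hp])
  · exact integral_congr_ae (hσ.ae_neg.mono fun p hp => by simp [hp])

theorem IsSign.measurable_mul (hσ : IsSign π σ) (b : π.L1) : Measurable fun p => σ p * b p :=
  hσ.measurable.mul (Lp.stronglyMeasurable b).measurable

theorem IsSign.integrable_mul (hσ : IsSign π σ) (b : π.L1) :
    Integrable (fun p => σ p * b p) π.tv :=
  (L1.integrable_coeFn b).bdd_mul (c := 1) hσ.measurable.aestronglyMeasurable <|
    ae_of_all _ fun p => by rcases hσ.eq_or_eq p with h | h <;> simp [h]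

theorem IsSign.ae_reflect_of_isOdd (hσ : IsSign π σ) (hπ : π.IsOdd) :
    ∀ᵐ p ∂π.tv, σ (reflect p) = -1 * σ p := by
  refine ae_add_measure_iff.2 ⟨?_, ?_⟩
  · have h := hσ.ae_neg
    rw [← hπ.1] at h
    filter_upwards [hσ.ae_pos, ae_of_ae_map measurable_reflect.aemeasurable h] with p h1 h2
    rw [h1, h2, mul_one]
  · have h := hσ.ae_pos
    rw [← hπ.2] at h
    filter_upwards [hσ.ae_neg, ae_of_ae_map measurable_reflect.aemeasurable h] with p h1 h2
    rw [h1, h2]; norm_num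

theorem IsSign.ae_reflect_of_isEven (hσ : IsSign π σ) (hπ : π.IsEven) :
    ∀ᵐ p ∂π.tv, σ (reflect p) = 1 * σ p := by
  refine ae_add_measure_iff.2 ⟨?_, ?_⟩
  · have h := hσ.ae_pos
    rw [← hπ.1] at h
    filter_upwards [hσ.ae_pos, ae_of_ae_map measurable_reflect.aemeasurable h] with p h1 h2
    rw [h1, h2, mul_one]
  · have h := hσ.ae_neg
    rw [← hπ.2] at h
    filter_upwards [hσ.ae_neg, ae_of_ae_map measurable_reflect.aemeasurable h] with p h1 h2
    rw [h1, h2, one_mul]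

theorem RealMeasure.IsOdd.map_tv (hπ : π.IsOdd) : π.tv.map reflect = π.tv := by
  rw [RealMeasure.tv, Measure.map_add _ _ measurable_reflect, hπ.1, hπ.2, add_comm]

theorem RealMeasure.IsEven.map_tv (hπ : π.IsEven) : π.tv.map reflect = π.tv := by
  rw [RealMeasure.tv, Measure.map_add _ _ measurable_reflect, hπ.1, hπ.2]

/-- The reflection fixes the line `α = 0` pointwise, whereas it changes the sign of an odd `π`. -/
theorem IsSign.ae_fst_ne_zero (hσ : IsSign π σ) (hπ : π.IsOdd) : ∀ᵐ p ∂π.tv, p.1 ≠ 0 := by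
  filter_upwards [hσ.ae_reflect_of_isOdd hπ] with p hp h0
  have : reflect p = p := by ext <;> simp [reflect, h0]
  rw [this] at hp
  rcases hσ.eq_or_eq p with h | h <;> rw [h] at hp <;> norm_num at hp

/-! ### The mixture and the score kernel -/

/-- The diagonal has to be left out: on it the kernel is unbounded along `α t = β`. -/
theorem integrable_kernel_mul (b : π.L1) {t : ℝ × ℝ} (h1 : 0 < t.1) (h2 : 0 < t.2)
    (h : t.1 ≠ t.2) : Integrable (fun p => kernel t p * b p) π.tv := by
  simp_rw [kernel_eq h1 h2, mul_assoc]
  exact (integrable_weight_mul (L1.integrable_coeFn b) (add_pos h1 h2)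
    (four_lt_sum_mul h1 h2 h)).const_mul _

theorem IsSign.mixture_eq (hσ : IsSign π σ) (b : π.L1) {t : ℝ × ℝ} (h1 : 0 < t.1) (h2 : 0 < t.2)
    (h : t.1 ≠ t.2) : mixture π b t = (t.1 ^ (3 / 2 : ℝ) * t.2 ^ (3 / 2 : ℝ))⁻¹ *
      ∫ p, weight (t.1 + t.2) ((t.1 + t.2) / (t.1 * t.2)) p * (σ p * b p) ∂π.tv := by
  rw [mixture, hσ.integral_eq (integrable_kernel_mul b h1 h2 h), ← integral_const_mul]
  refine integral_congr_ae (ae_of_all _ fun p => ?_)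
  simp only [kernel_eq h1 h2]
  ring

theorem mixture_sub (l l' : π.L1) {t : ℝ × ℝ} (h1 : 0 < t.1) (h2 : 0 < t.2) (h : t.1 ≠ t.2) :
    mixture π (l - l') t = mixture π l t - mixture π l' t := by
  obtain ⟨σ, hσ⟩ := exists_isSign π
  rw [hσ.mixture_eq _ h1 h2 h, hσ.mixture_eq _ h1 h2 h, hσ.mixture_eq _ h1 h2 h, ← mul_sub,
    ← integral_sub (integrable_weight_mul (hσ.integrable_mul l) (add_pos h1 h2)
      (four_lt_sum_mul h1 h2 h)) (integrable_weight_mul (hσ.integrable_mul l') (add_pos h1 h2)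
      (four_lt_sum_mul h1 h2 h))]
  congr 1
  refine integral_congr_ae ?_
  filter_upwards [Lp.coeFn_sub l l'] with p hp
  rw [hp, Pi.sub_apply]
  ring

variable {T : Set ℝ} {l₀ : π.L1}

theorem ae_spellMeasure (hT0 : T ⊆ Ici 0) (hTconv : Convex ℝ T) :
    ∀ᵐ t ∂spellMeasure T, 0 < t.1 ∧ 0 < t.2 ∧ t.1 ≠ t.2 := by
  have hTm : MeasurableSet T := hTconv.ordConnected.measurableSet
  have hne : ∀ᵐ x : ℝ, x ≠ 0 := ae_iff.2 (by simp)
  have hfst : ∀ᵐ t : ℝ × ℝ, t.1 ≠ 0 := Measure.quasiMeasurePreserving_fst.ae hne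
  have hsnd : ∀ᵐ t : ℝ × ℝ, t.2 ≠ 0 := Measure.quasiMeasurePreserving_snd.ae hne
  have hdiag : ∀ᵐ t : ℝ × ℝ, t.1 ≠ t.2 := by
    have hm : MeasurableSet {t : ℝ × ℝ | t.1 = t.2} := measurableSet_eq_fun (by fun_prop)
      (by fun_prop)
    rw [ae_iff]
    simp only [ne_eq, not_not]
    refine (Measure.measure_prod_null hm).2 (ae_of_all _ fun x => ?_)
    have : Prod.mk x ⁻¹' {t : ℝ × ℝ | t.1 = t.2} = {x} := by ext y; simp [eq_comm]
    simp [this]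
  refine (ae_restrict_iff' (hTm.prod hTm)).2 ?_
  filter_upwards [hfst, hsnd, hdiag] with t h1 h2 h ht
  exact ⟨lt_of_le_of_ne (hT0 ht.1) h1.symm, lt_of_le_of_ne (hT0 ht.2) h2.symm, h⟩

theorem mem_scoreKernel_of_mixture_eq_zero {b : π.L1}
    (h : ∀ᵐ t ∂spellMeasure T, mixture π b t = 0) : b ∈ scoreKernel π T l₀ := by
  refine (withDensity_absolutelyContinuous (spellMeasure T) _).ae_le ?_
  filter_upwards [h] with t ht
  simp [score, density, ht]

theorem IsSign.measurable_integral_weight (hσ : IsSign π σ) (b : π.L1) :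
    Measurable fun t : ℝ × ℝ =>
      ∫ p, weight (t.1 + t.2) ((t.1 + t.2) / (t.1 * t.2)) p * (σ p * b p) ∂π.tv := by
  have := isSFinite_tv π
  have hw : Measurable fun q : (ℝ × ℝ) × Het =>
      weight (q.1.1 + q.1.2) ((q.1.1 + q.1.2) / (q.1.1 * q.1.2)) q.2 := by
    unfold weight; fun_prop
  exact (hw.mul ((hσ.measurable_mul b).comp measurable_snd)).stronglyMeasurable
    |>.integral_prod_right.measurable

/-- The score vanishes `ℙ`-almost surely, so the mixture of `b` vanishes where the true density is
positive.  That set has positive measure, and the identity theorem applies. -/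
theorem IsSign.integral_weight_eq_zero_of_mem_scoreKernel (hσ : IsSign π σ)
    (hT0 : T ⊆ Ici 0) (hTconv : Convex ℝ T) (hC : 0 < normConst π T l₀) {b : π.L1}
    (hb : b ∈ scoreKernel π T l₀) {s v : ℝ} (hs : 0 < s) (hv : 4 < s * v) :
    ∫ p, weight s v p * (σ p * b p) ∂π.tv = 0 := by
  -- a non-integrable mixture would have integral `0`
  have hint : Integrable (mixture π l₀) (spellMeasure T) := by
    by_contra h
    rw [normConst, integral_undef h] at hC
    exact hC.false
  have hae := (ae_withDensity_iff' (by
    exact (hint.aemeasurable.const_mul _).ennreal_ofReal)).1 hb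
  have hgood := ae_spellMeasure hT0 hTconv
  set Z : Set (ℝ × ℝ) := {t | 0 < t.1 ∧ 0 < t.2 ∧ t.1 ≠ t.2 ∧
    ∫ p, weight (t.1 + t.2) ((t.1 + t.2) / (t.1 * t.2)) p * (σ p * b p) ∂π.tv = 0} with hZ
  have hZm : MeasurableSet Z :=
    (measurableSet_lt measurable_const measurable_fst).inter <|
    (measurableSet_lt measurable_const measurable_snd).inter <|
    (measurableSet_eq_fun measurable_fst measurable_snd).compl.inter <|
    measurableSet_eq_fun (hσ.measurable_integral_weight b) measurable_const
  refine integral_weight_eq_zero (hσ.measurable_mul b) (hσ.integrable_mul b) hZm (fun hZ0 => ?_)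
    (fun t ht => ht) hs hv
  have hZae : ∀ᵐ t ∂spellMeasure T, t ∉ Z := ae_restrict_of_ae (compl_mem_ae_iff.2 hZ0)
  refine hC.not_ge (integral_nonpos_of_ae ?_)
  filter_upwards [hae, hgood, hZae] with t h1 h2 h3
  by_contra hpos
  simp only [Pi.zero_apply, not_le] at hpos
  have hd : 0 < density π T l₀ l₀ t := mul_pos (inv_pos.2 hC) hpos
  have h4 := h1 (ENNReal.ofReal_pos.2 hd).ne'
  refine h3 ⟨h2.1, h2.2.1, h2.2.2, ?_⟩
  rw [score, div_eq_zero_iff, or_iff_left hd.ne', density, mul_eq_zero,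
    or_iff_right (inv_pos.2 hC).ne', hσ.mixture_eq b h2.1 h2.2.1 h2.2.2, mul_eq_zero] at h4
  refine h4.resolve_left (inv_ne_zero (mul_pos ?_ ?_).ne')
  exacts [Real.rpow_pos_of_pos h2.1 _, Real.rpow_pos_of_pos h2.2.1 _]

theorem IsSign.mem_scoreKernel_iff_mixture (hσ : IsSign π σ)
    (hT0 : T ⊆ Ici 0) (hTconv : Convex ℝ T) (hC : 0 < normConst π T l₀) (b : π.L1) :
    b ∈ scoreKernel π T l₀ ↔ ∀ᵐ t ∂spellMeasure T, mixture π b t = 0 := by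
  refine ⟨fun hb => ?_, mem_scoreKernel_of_mixture_eq_zero⟩
  filter_upwards [ae_spellMeasure hT0 hTconv] with t ht
  rw [hσ.mixture_eq b ht.1 ht.2.1 ht.2.2,
    hσ.integral_weight_eq_zero_of_mem_scoreKernel hT0 hTconv hC hb (add_pos ht.1 ht.2.1)
      (four_lt_sum_mul ht.1 ht.2.1 ht.2.2), mul_zero]

/-- The score kernel when the reflection multiplies `π` by `ε = ±1`: the even part of
`weight s v · b` with respect to `π` vanishes, and `weight s v` gains the factor `exp (-4αβ)` under
the reflection. -/
theorem IsSign.mem_scoreKernel_iff (hσ : IsSign π σ) (hβ : π.tv {p : Het | p.2 = 0} = 0)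
    (hT0 : T ⊆ Ici 0) (hTconv : Convex ℝ T) (hC : 0 < normConst π T l₀)
    {ε : ℝ} (htv : π.tv.map reflect = π.tv)
    (hσε : ∀ᵐ p ∂π.tv, σ (reflect p) = ε * σ p) (b : π.L1) :
    b ∈ scoreKernel π T l₀ ↔
      ∀ᵐ p ∂π.tv, b p = -ε * (Real.exp (-4 * p.1 * (p.2 : ℝ)) * b (reflect p)) := by
  constructor
  · intro hb
    -- any base point with `4 < s v` would do; shifting it by `(2 m, 2 n)` produces the factors
    -- `exp (-(m α² + n β²))`
    have h0 := ae_add_reflect_eq_zero htv (w := fun p => weight 4 4 p * (σ p * b p))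
      ((measurable_weight 4 4).mul (hσ.measurable_mul b))
      (integrable_weight_mul (hσ.integrable_mul b) (by norm_num) (by norm_num)) fun m n => by
        rw [← hσ.integral_weight_eq_zero_of_mem_scoreKernel hT0 hTconv hC hb
          (s := 4 + 2 * m) (v := 4 + 2 * n) (by positivity)
          (by nlinarith [mul_nonneg (Nat.cast_nonneg (α := ℝ) m) (Nat.cast_nonneg (α := ℝ) n),
            Nat.cast_nonneg (α := ℝ) m, Nat.cast_nonneg (α := ℝ) n])]
        refine integral_congr_ae (ae_of_all _ fun p => ?_)
        simp only
        rw [← mul_assoc]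
        congr 1
        unfold weight
        rw [mul_left_comm, ← Real.exp_add]
        ring_nf
    have hβ' : ∀ᵐ p ∂π.tv, p.2 ≠ 0 := compl_mem_ae_iff.2 hβ
    filter_upwards [h0, hβ', hσε] with p h1 h2 h3
    have hσ0 : σ p ≠ 0 := by rcases hσ.eq_or_eq p with h | h <;> simp [h]
    have hw : weight 4 4 p * σ p ≠ 0 := mul_ne_zero (weight_pos 4 4 h2).ne' hσ0
    refine mul_left_cancel₀ hw ?_
    rw [weight_reflect, h3] at h1
    linear_combination h1
  · intro hb
    refine mem_scoreKernel_of_mixture_eq_zero ?_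
    filter_upwards [ae_spellMeasure hT0 hTconv] with t ht
    rw [hσ.mixture_eq b ht.1 ht.2.1 ht.2.2, mul_eq_zero]
    right
    set s := t.1 + t.2
    set v := (t.1 + t.2) / (t.1 * t.2)
    have h1 : ∫ p, weight s v (reflect p) * (σ (reflect p) * b (reflect p)) ∂π.tv =
        ∫ p, weight s v p * (σ p * b p) ∂π.tv :=
      integral_comp_reflect htv ((measurable_weight s v).mul (hσ.measurable_mul b))
    have h2 : ∫ p, weight s v (reflect p) * (σ (reflect p) * b (reflect p)) ∂π.tv =
        -∫ p, weight s v p * (σ p * b p) ∂π.tv := by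
      rw [← integral_neg]
      refine integral_congr_ae ?_
      filter_upwards [hb, hσε] with p h1 h2
      rw [weight_reflect, h2, h1]
      ring
    linarith

theorem mem_identifiedSet_iff (hT0 : T ⊆ Ici 0) (hTconv : Convex ℝ T)
    (hC : 0 < normConst π T l₀) (Λ : Set π.L1) (l : π.L1) :
    l ∈ identifiedSet π T l₀ Λ ↔ l ∈ Λ ∧ l - l₀ ∈ scoreKernel π T l₀ := by
  obtain ⟨σ, hσ⟩ := exists_isSign π
  rw [hσ.mem_scoreKernel_iff_mixture hT0 hTconv hC]
  refine and_congr_right fun _ => Filter.eventually_congr ?_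
  filter_upwards [ae_spellMeasure hT0 hTconv] with t ht
  rw [density, density, mul_right_inj' (inv_pos.2 hC).ne', mixture_sub l l₀ ht.1 ht.2.1 ht.2.2,
    sub_eq_zero]

end TwoSpell

theorem proposition6
    (π : TwoSpell.RealMeasure)
    (hβ : π.tv {p : TwoSpell.Het | p.2 = 0} = 0)
    (T : Set ℝ) (hT0 : T ⊆ Set.Ici 0) (hTconv : Convex ℝ T) (hTint : (interior T).Nonempty)
    (l₀ : π.L1) (hl₀ : TwoSpell.IsTruth π T l₀) :
    -- the integral that defines the score operator exists for every direction in `L₁(π)`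
    (∀ b : π.L1, ∀ᵐ t ∂TwoSpell.spellMeasure T,
      Integrable (fun p => TwoSpell.kernel t p * b p) π.tv) ∧
    -- the kernel of the score operator, when `dπ(-α, β) = -dπ(α, β)`
    (π.IsOdd → TwoSpell.scoreKernel π T l₀ =
      {b : π.L1 | ∀ᵐ p ∂π.tv,
        b p = Real.exp (-4 * p.1 * (p.2 : ℝ)) * b (TwoSpell.reflect p)}) ∧
    -- the kernel of the score operator, when `dπ(-α, β) = dπ(α, β)`
    (π.IsEven → TwoSpell.scoreKernel π T l₀ =
      {b : π.L1 | ∀ᵐ p ∂π.tv,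
        b p = -(Real.exp (-4 * p.1 * (p.2 : ℝ)) * b (TwoSpell.reflect p))}) ∧
    -- the identified set
    (∀ Λ : Set π.L1, l₀ ∈ Λ → TwoSpell.identifiedSet π T l₀ Λ =
      {l : π.L1 | l ∈ Λ ∧ ∃ b ∈ TwoSpell.scoreKernel π T l₀, l = l₀ + b}) ∧
    -- identification among the functions that are symmetric in `α`
    (π.IsOdd ∨ π.IsEven → ∀ Λ : Set π.L1, l₀ ∈ Λ →
      (∀ l ∈ Λ, ∀ᵐ p ∂π.tv, l p = l (TwoSpell.reflect p)) →
      TwoSpell.identifiedSet π T l₀ Λ = {l₀}) := by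
  obtain ⟨σ, hσ⟩ := TwoSpell.exists_isSign π
  have hC := hl₀.2
  have hβ' : ∀ᵐ p ∂π.tv, p.2 ≠ 0 := compl_mem_ae_iff.2 hβ
  have hodd : π.IsOdd → ∀ b : π.L1, b ∈ TwoSpell.scoreKernel π T l₀ ↔ ∀ᵐ p ∂π.tv,
      b p = Real.exp (-4 * p.1 * (p.2 : ℝ)) * b (TwoSpell.reflect p) := fun hπ b => by
    simpa using hσ.mem_scoreKernel_iff hβ hT0 hTconv hC hπ.map_tv
      (hσ.ae_reflect_of_isOdd hπ) b
  have heven : π.IsEven → ∀ b : π.L1, b ∈ TwoSpell.scoreKernel π T l₀ ↔ ∀ᵐ p ∂π.tv,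
      b p = -(Real.exp (-4 * p.1 * (p.2 : ℝ)) * b (TwoSpell.reflect p)) := fun hπ b => by
    simpa using hσ.mem_scoreKernel_iff hβ hT0 hTconv hC hπ.map_tv
      (hσ.ae_reflect_of_isEven hπ) b
  refine ⟨fun b => ?_, fun hπ => Set.ext (hodd hπ), fun hπ => Set.ext (heven hπ),
    fun Λ _ => Set.ext fun l => ?_, fun hπ Λ hΛ hsymm => Set.ext fun l => ?_⟩
  · filter_upwards [TwoSpell.ae_spellMeasure hT0 hTconv] with t ht
    exact TwoSpell.integrable_kernel_mul b ht.1 ht.2.1 ht.2.2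
  · rw [TwoSpell.mem_identifiedSet_iff hT0 hTconv hC]
    refine and_congr_right fun _ => ⟨fun h => ⟨_, h, (add_sub_cancel _ _).symm⟩, ?_⟩
    rintro ⟨b, hb, rfl⟩
    rwa [add_sub_cancel_left]
  · rw [TwoSpell.mem_identifiedSet_iff hT0 hTconv hC]
    constructor
    · rintro ⟨hl, hb⟩
      refine sub_eq_zero.1 (Lp.ext ?_)
      have htv : π.tv.map TwoSpell.reflect = π.tv := hπ.elim (·.map_tv) (·.map_tv)
      have hsub := Lp.coeFn_sub l l₀
      have hsub' : ∀ᵐ p ∂π.tv, (l - l₀ : π.L1) (TwoSpell.reflect p) =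
          l (TwoSpell.reflect p) - l₀ (TwoSpell.reflect p) :=
        (MeasurePreserving.mk TwoSpell.measurable_reflect htv).quasiMeasurePreserving.ae hsub
      have heq : ∀ᵐ p ∂π.tv,
          (l - l₀ : π.L1) p = (l - l₀ : π.L1) (TwoSpell.reflect p) := by
        filter_upwards [hsub, hsub', hsymm l hl, hsymm l₀ hΛ] with p h1 h2 h3 h4
        rw [h1, h2, Pi.sub_apply, h3, h4]
      rcases hπ with hπ | hπ
      · filter_upwards [heq, (hodd hπ _).1 hb, hσ.ae_fst_ne_zero hπ, hβ', Lp.coeFn_zero ℝ 1 π.tv]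
          with p h1 h2 h3 h4 h5
        rw [h5]
        have hne : Real.exp (-4 * p.1 * (p.2 : ℝ)) ≠ 1 := by
          simp [h3, h4]
        rw [← h1] at h2
        refine (mul_eq_zero.1 (show (Real.exp (-4 * p.1 * (p.2 : ℝ)) - 1) *
          (l - l₀ : π.L1) p = 0 by linarith)).resolve_left (sub_ne_zero.2 hne)
      · filter_upwards [heq, (heven hπ _).1 hb, Lp.coeFn_zero ℝ 1 π.tv] with p h1 h2 h5
        rw [h5]
        rw [← h1] at h2
        refine (mul_eq_zero.1 (show (Real.exp (-4 * p.1 * (p.2 : ℝ)) + 1) *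
          (l - l₀ : π.L1) p = 0 by linarith)).resolve_left (by positivity)
    · rintro rfl
      refine ⟨hΛ, TwoSpell.mem_scoreKernel_of_mixture_eq_zero ?_⟩
      filter_upwards [TwoSpell.ae_spellMeasure hT0 hTconv] with t ht
      rw [TwoSpell.mixture_sub _ _ ht.1 ht.2.1 ht.2.2, sub_self]
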